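/- We work in $[0,1]$-valued continuous first-order logic: structures are nonempty complete metric spaces of diameter at most $1$ with uniformly continuous functions and $[0,1]$-valued predicates obeying the moduli given by the language; connectives are all continuous functions $[0,1]^k\to[0,1]$ and quantifiers are $\sup$ and $\inf$. Let $T$ be a complete theory (the set of all closed conditions $\sigma=0$ that hold in some structure) and let $\mathcal U$ be a monster model of $T$, that is, a $\kappa$-saturated and strongly $\kappa$-homogeneous model for some uncountable $\kappa>|L|$. A formula $\phi(x,y)$ (with $x,y$ finite tuples of variables) has SOP if there are $\epsilon>0$ and a sequence $(a_ib_i:i<\omega)$ of tuples in $\mathcal U$ such that for all $i<j<\omega$ $$\phi(c,a_i)\le\phi(c,a_{i+1})\ \text{ for every } x\text{-tuple } c \text{ in } \mathcal U,\qquad\text{and}\qquad \phi(b_j,a_i)+\epsilon\le\phi(b_{i+1},a_j);$$ $T$ has SOP if some formula has SOP. Let $S_\phi(\mathcal U)$ be the space of complete $\phi$-types over $\mathcal U$, that is, of all functions $p:b\mapsto\phi(c,b)$ on the $y$-tuples $b$ of $\mathcal U$, where $c$ is an $x$-tuple in an elementary extension of $\mathcal U$, with the topology of pointwise convergence. For a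 $y$-tuple $a$ of $\mathcal U$ let $\phi(x,a):S_\phi(\mathcal U)\to[0,1]$ be the continuous function $p\mapsto p(a)$. Let $s_n=e_0+\dots+e_n$ $(n<\omega)$ be the summing basis of the real Banach space $c_0$, where $e_n$ are the unit vectors. **Proposition.** If $T$ has SOP, then there are a formula $\phi(x,y)$ and a sequence $(a_i)_{i<\omega}$ of $y$-tuples in $\mathcal U$ such that the sequence of functions $\phi(x,a_i):S_\phi(\mathcal U)\to[0,1]$ is equivalent, in the supremum norm, to the summing basis of $c_0$: there are constants $c,C>0$ such that for all $k$ and all real scalars $r_0,\dots,r_{k-1}$ $$c\,\Big\|\sum_{i<k}r_is_i\Big\|_{c_0}\le\Big\|\sum_{i<k}r_i\,\phi(x,a_i)\Big\|_\infty\le C\,\Big\|\sum_{i<k}r_is_i\Big\|_{c_0}.$$ -/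

import Mathlib

open scoped BoundedContinuousFunction ZeroAtInfty Cardinal

universe u v w u'

namespace ContinuousLogic

/-! ### Languages and metric structures

Continuous first order logic, with `[0,1]`-valued predicates and metrics bounded by `1`. -/

/-- A modulus of uniform continuity: a function `(0,1] → (0,1]`. -/
abbrev Modulus : Type := Set.Ioc (0 : ℝ) 1 → Set.Ioc (0 : ℝ) 1

/-- A signature for metric structures: function symbols (constants being the 0-ary ones) and
predicate symbols with their arities, each with a modulus of uniform continuity. -/
structure MetricLanguage extends FirstOrder.Language.{u, v} where
  funModulus : ∀ {n : ℕ}, Functions n → Modulus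
  predModulus : ∀ {n : ℕ}, Relations n → Modulus

/-- A metric structure for `L`: a nonempty complete metric space of diameter at most `1` with
interpretations of the symbols that obey the moduli. Here `Fin n → carrier` carries the maximum
metric. -/
structure MetricStructure (L : MetricLanguage.{u, v}) where
  carrier : Type w
  [metricSpace : MetricSpace carrier]
  [completeSpace : CompleteSpace carrier]
  [nonempty : Nonempty carrier]
  dist_le_one : ∀ x y : carrier, dist x y ≤ 1
  funMap : ∀ {n : ℕ}, L.Functions n → (Fin n → carrier) → carrier
  predMap : ∀ {n : ℕ}, L.Relations n → (Fin n → carrier) → unitInterval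
  funMap_uniform : ∀ {n : ℕ} (f : L.Functions n) (ε : Set.Ioc (0 : ℝ) 1) (x y : Fin n → carrier),
    dist x y < L.funModulus f ε → dist (funMap f x) (funMap f y) ≤ ε
  predMap_uniform : ∀ {n : ℕ} (R : L.Relations n) (ε : Set.Ioc (0 : ℝ) 1) (x y : Fin n → carrier),
    dist x y < L.predModulus R ε → dist (predMap R x) (predMap R y) ≤ ε

instance (L : MetricLanguage.{u, v}) : CoeSort (MetricStructure.{u, v, w} L) (Type w) :=
  ⟨MetricStructure.carrier⟩

attribute [instance] MetricStructure.metricSpace MetricStructure.completeSpace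
  MetricStructure.nonempty

variable {L : MetricLanguage.{u, v}}

/-! ### Formulas and their values -/

/-- Formulas with free variables indexed by `α` and `n` further variables (indexed by `Fin n`)
available for quantification. Every continuous function `[0,1]^k → [0,1]` is a connective and
the quantifiers are `sup` and `inf`. -/
inductive BoundedFormula (L : MetricLanguage.{u, v}) (α : Type u') : ℕ → Type (max u v u')
  | dist {n : ℕ} (s t : L.toLanguage.Term (α ⊕ Fin n)) : BoundedFormula L α n
  | pred {n k : ℕ} (R : L.Relations k) (ts : Fin k → L.toLanguage.Term (α ⊕ Fin n)) :
      BoundedFormula L α n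
  | conn {n k : ℕ} (c : C(Fin k → unitInterval, unitInterval))
      (φs : Fin k → BoundedFormula L α n) : BoundedFormula L α n
  | sup {n : ℕ} (φ : BoundedFormula L α (n + 1)) : BoundedFormula L α n
  | inf {n : ℕ} (φ : BoundedFormula L α (n + 1)) : BoundedFormula L α n

/-- Formulas with free variables indexed by `α`. -/
abbrev Formula (L : MetricLanguage.{u, v}) (α : Type u') : Type (max u v u') :=
  BoundedFormula L α 0

/-- Formulas without free variables. -/
abbrev Sentence (L : MetricLanguage.{u, v}) : Type (max u v) := Formula L Empty

/-- The value of a term. -/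
def termValue (M : MetricStructure.{u, v, w} L) {β : Type u'} (x : β → M) :
    L.toLanguage.Term β → M
  | .var i => x i
  | .func f ts => M.funMap f (fun i => termValue M x (ts i))

/-- The value of a formula, a number in `[0,1]` (`0` means true). -/
noncomputable def BoundedFormula.value (M : MetricStructure.{u, v, w} L) {α : Type u'}
    (x : α → M) : {n : ℕ} → BoundedFormula L α n → (Fin n → M) → unitInterval
  | _, .dist s t, z =>
      ⟨Dist.dist (termValue M (Sum.elim x z) s) (termValue M (Sum.elim x z) t),
        dist_nonneg, M.dist_le_one _ _⟩
  | _, .pred R ts, z => M.predMap R (fun i => termValue M (Sum.elim x z) (ts i))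
  | _, .conn c φs, z => c (fun i => (φs i).value M x z)
  | _, .sup φ, z => ⨆ y : M, φ.value M x (Fin.snoc z y)
  | _, .inf φ, z => ⨅ y : M, φ.value M x (Fin.snoc z y)

/-- The value `φ^M(x)` of a formula `φ` at an assignment `x` of its free variables. -/
noncomputable def Formula.eval {α : Type u'} (φ : Formula L α) (M : MetricStructure.{u, v, w} L)
    (x : α → M) : unitInterval :=
  BoundedFormula.value M x φ Fin.elim0

/-! ### Theories, elementary embeddings, monster models -/

/-- A theory: a set of closed conditions `σ = 0`, given by the sentences `σ`. -/
abbrev Theory (L : MetricLanguage.{u, v}) : Type (max u v) := Set (Sentence L)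

/-- `M` is a model of `T`. -/
def Models (M : MetricStructure.{u, v, w} L) (T : Theory L) : Prop :=
  ∀ σ ∈ T, Formula.eval σ M Empty.elim = 0

/-- `Th(M)`, the set of all closed conditions that hold in `M`. -/
def completeTheory (M : MetricStructure.{u, v, w} L) : Theory L :=
  {σ | Formula.eval σ M Empty.elim = 0}

/-- A theory is complete if it is the theory of some metric structure. -/
def IsCompleteTheory (T : Theory L) : Prop :=
  ∃ M : MetricStructure.{u, v, w} L, T = completeTheory M

/-- `j : M → N` is an elementary embedding: it preserves the value of every formula. -/
def IsElementaryEmbedding (M N : MetricStructure.{u, v, w} L) (j : M → N) : Prop :=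
  ∀ (k : ℕ) (φ : Formula L (Fin k)) (x : Fin k → M), φ.eval N (j ∘ x) = φ.eval M x

/-- `σ` is an automorphism of `M`. -/
def IsAutomorphism (M : MetricStructure.{u, v, w} L) (σ : M ≃ M) : Prop :=
  Isometry σ ∧
  (∀ (n : ℕ) (f : L.Functions n) (x : Fin n → M), σ (M.funMap f x) = M.funMap f (σ ∘ x)) ∧
  (∀ (n : ℕ) (R : L.Relations n) (x : Fin n → M), M.predMap R (σ ∘ x) = M.predMap R x)

/-- `M` is `κ`-saturated: a set of conditions in finitely many variables, with parameters from a
set of fewer than `κ` elements of `M`, is satisfied in `M` if each finite part of it is. -/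
def IsSaturated (κ : Cardinal.{w}) (M : MetricStructure.{u, v, w} L) : Prop :=
  ∀ A : Set M, #A < κ → ∀ (m : ℕ) (Γ : Set (Formula L (A ⊕ Fin m))),
    (∀ Γ₀ ⊆ Γ, Γ₀.Finite →
      ∃ x : Fin m → M, ∀ φ ∈ Γ₀, φ.eval M (Sum.elim (fun a : A => (a : M)) x) = 0) →
    ∃ x : Fin m → M, ∀ φ ∈ Γ, φ.eval M (Sum.elim (fun a : A => (a : M)) x) = 0

/-- `M` is strongly `κ`-homogeneous: two families of length less than `κ` with the same type are
conjugate under an automorphism of `M`. -/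
def IsStronglyHomogeneous (κ : Cardinal.{w}) (M : MetricStructure.{u, v, w} L) : Prop :=
  ∀ (ι : Type w), #ι < κ → ∀ a b : ι → M,
    (∀ φ : Formula L ι, φ.eval M a = φ.eval M b) →
    ∃ σ : M ≃ M, IsAutomorphism M σ ∧ σ ∘ a = b

/-- `U` is a monster model of `T`: a `κ`-saturated, strongly `κ`-homogeneous model of `T`, where
`κ` is uncountable and exceeds the cardinality of the language. -/
def IsMonsterModel (κ : Cardinal.{w}) (T : Theory L) (U : MetricStructure.{u, v, w} L) : Prop :=
  ℵ₀ < κ ∧ Cardinal.lift.{w} L.toLanguage.card < Cardinal.lift.{max u v} κ ∧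
  Models U T ∧ IsSaturated κ U ∧ IsStronglyHomogeneous κ U

/-! ### The strict order property -/

/-- The value `φ^M(x, y)` of a formula whose free variables are split into two tuples. -/
noncomputable def Formula.eval₂ {m n : ℕ} (φ : Formula L (Fin m ⊕ Fin n))
    (M : MetricStructure.{u, v, w} L) (x : Fin m → M) (y : Fin n → M) : unitInterval :=
  φ.eval M (Sum.elim x y)

/-- `φ(x,y)` has the `ε`-strict order property, witnessed in the (monster) model `U`. -/
def HasEpsSOP (U : MetricStructure.{u, v, w} L) {m n : ℕ} (φ : Formula L (Fin m ⊕ Fin n))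
    (ε : ℝ) : Prop :=
  ∃ (a : ℕ → Fin n → U) (b : ℕ → Fin m → U), ∀ i j : ℕ, i < j →
    (∀ x : Fin m → U, φ.eval₂ U x (a i) ≤ φ.eval₂ U x (a (i + 1))) ∧
    (φ.eval₂ U (b j) (a i) : ℝ) + ε ≤ φ.eval₂ U (b (i + 1)) (a j)

/-- `φ(x,y)` has the strict order property. -/
def FormulaHasSOP (U : MetricStructure.{u, v, w} L) {m n : ℕ}
    (φ : Formula L (Fin m ⊕ Fin n)) : Prop :=
  ∃ ε : ℝ, 0 < ε ∧ HasEpsSOP U φ ε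

/-- A theory with monster model `U` has the strict order property if some formula has it. -/
def HasSOP (U : MetricStructure.{u, v, w} L) : Prop :=
  ∃ (m n : ℕ) (φ : Formula L (Fin m ⊕ Fin n)), FormulaHasSOP U φ

/-! ### The space of `φ`-types -/

/-- `S_φ(U)`: the functions `b ↦ φ(c,b)` on the `y`-tuples `b` of `U`, where `c` is an `x`-tuple
in an elementary extension of `U`. As a subset of a product it has the topology of pointwise
convergence, the least one that makes all evaluations `p ↦ p b` continuous. -/
def phiTypes (U : MetricStructure.{u, v, w} L) {m n : ℕ} (φ : Formula L (Fin m ⊕ Fin n)) :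
    Set ((Fin n → U) → unitInterval) :=
  {p | ∃ (N : MetricStructure.{u, v, w} L) (j : U → N) (c : Fin m → N),
    IsElementaryEmbedding U N j ∧ ∀ b : Fin n → U, p b = φ.eval₂ N c (j ∘ b)}

/-- The function `φ(x,a) : S_φ(U) → [0,1]`, as an element of the space of bounded continuous
real functions on `S_φ(U)` with the supremum norm. -/
noncomputable def instanceFun (U : MetricStructure.{u, v, w} L) {m n : ℕ}
    (φ : Formula L (Fin m ⊕ Fin n)) (a : Fin n → U) : phiTypes U φ →ᵇ ℝ :=
  BoundedContinuousFunction.mkOfBound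
    ⟨fun p => ((p.1 a : unitInterval) : ℝ),
      continuous_subtype_val.comp ((continuous_apply a).comp continuous_subtype_val)⟩ 1
    (fun p q => by
      have hp := (p.1 a).2
      have hq := (q.1 a).2
      simp only [ContinuousMap.coe_mk, Real.dist_eq, abs_le]
      constructor <;> linarith [hp.1, hp.2, hq.1, hq.2])

/-! ### The summing basis of `c₀` -/

/-- The unit vector `e_n` of `c₀`, the space of real sequences that tend to `0`. -/
noncomputable def c0UnitVector (n : ℕ) : C₀(ℕ, ℝ) where
  toFun := Pi.single n 1
  continuous_toFun := continuous_of_discreteTopology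
  zero_at_infty' := by
    rw [Filter.cocompact_eq_cofinite]
    refine tendsto_nhds_of_eventually_eq ?_
    rw [Filter.eventually_cofinite]
    refine (Set.finite_singleton n).subset fun k hk => ?_
    by_contra hne
    exact hk (Pi.single_eq_of_ne hne 1)

/-- The summing basis of `c₀`: `s_n = e_0 + ⋯ + e_n`. -/
noncomputable def summingBasis (n : ℕ) : C₀(ℕ, ℝ) :=
  ∑ i ∈ Finset.range (n + 1), c0UnitVector i

/-- Two sequences in real normed spaces are equivalent if the norms of their finite linear
combinations with the same coefficients are comparable up to two fixed positive constants. -/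
def EquivalentSequences {E F : Type*} [NormedAddCommGroup E] [NormedSpace ℝ E]
    [NormedAddCommGroup F] [NormedSpace ℝ F] (x : ℕ → E) (y : ℕ → F) : Prop :=
  ∃ c C : ℝ, 0 < c ∧ 0 < C ∧ ∀ (k : ℕ) (r : ℕ → ℝ),
    c * ‖∑ i ∈ Finset.range k, r i • y i‖ ≤ ‖∑ i ∈ Finset.range k, r i • x i‖ ∧
    ‖∑ i ∈ Finset.range k, r i • x i‖ ≤ C * ‖∑ i ∈ Finset.range k, r i • y i‖

end ContinuousLogic

namespace ContinuousLogic

/-! ### Turning free variables into bound ones -/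

/-! Let f(i,j) = φ(b_j, a_i), which increases in i. SOP compares entries with transposed entries,
without a common threshold. `exists_threshold` finds one, `exists_half_graph` passes to subsequences
with f ≤ t for i < j and f ≥ t + ε/2 for j ≤ i, and the increasing connective `stretch` turns these
values into 0 and 1 while keeping monotonicity. The equivalence is then isometric. The j-th
coordinate of Σ r_i s_i is the tail sum of the r_i over i ≥ j, which is also the value of Σ r_i
φ(x,a_i) at the type of b_j. Conversely, at any type p the numbers p(a_i) increase within [0,1], so
Abel summation (`abs_sum_mul_le_of_monotone`) gives a combination of tail sums with nonnegative
weights of total at most 1. Since p may be realised only in an elementary extension, monotonicity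
over U has to be transferred there; `leFormula` expresses it by a formula, which is what the
relabelling of variables serves. -/

theorem termValue_relabel (M : MetricStructure.{u, v, w} L) {β γ : Type*} (g : β → γ)
    (x : γ → M) (t : L.toLanguage.Term β) :
    termValue M x (t.relabel g) = termValue M (x ∘ g) t := by
  induction t with
  | var i => rfl
  | func f ts ih =>
    simp only [FirstOrder.Language.Term.relabel, termValue]
    congr 1
    funext i
    exact ih i

/-- The map on variables underlying `BoundedFormula.relabel`. -/
def relabelVar {α β : Type*} {k : ℕ} (g : α → β ⊕ Fin k) (n : ℕ) :
    α ⊕ Fin n → β ⊕ Fin (k + n) :=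
  Sum.elim (Sum.map id (Fin.castAdd n) ∘ g) (Sum.inr ∘ Fin.natAdd k)

/-- Replace the free variables of a formula by free variables indexed by another type, or by
variables that are available for quantification. -/
def BoundedFormula.relabel {α β : Type*} {k : ℕ} (g : α → β ⊕ Fin k) :
    {n : ℕ} → BoundedFormula L α n → BoundedFormula L β (k + n)
  | n, .dist s t => .dist (s.relabel (relabelVar g n)) (t.relabel (relabelVar g n))
  | n, .pred R ts => .pred R fun i => (ts i).relabel (relabelVar g n)
  | _, .conn c φs => .conn c fun i => (φs i).relabel g
  | _, .sup φ => .sup (n := k + _) (φ.relabel g)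
  | _, .inf φ => .inf (n := k + _) (φ.relabel g)

theorem elim_comp_relabelVar {α β X : Type*} {k n : ℕ} (g : α → β ⊕ Fin k) (x : β → X)
    (z : Fin (k + n) → X) :
    Sum.elim x z ∘ relabelVar g n =
      Sum.elim (Sum.elim x (z ∘ Fin.castAdd n) ∘ g) (z ∘ Fin.natAdd k) := by
  funext i
  rcases i with i | i
  · simp only [relabelVar, Function.comp_apply, Sum.elim_inl]
    rcases g i with j | j <;> rfl
  · rfl

theorem snoc_comp_castAdd {X : Type*} {k n : ℕ} (z : Fin (k + n) → X) (y : X) :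
    (Fin.snoc z y : Fin (k + n + 1) → X) ∘ Fin.castAdd (n + 1) = z ∘ Fin.castAdd n := by
  funext i
  exact Fin.snoc_castSucc (α := fun _ => X) y z (Fin.castAdd n i)

theorem snoc_comp_natAdd {X : Type*} {k n : ℕ} (z : Fin (k + n) → X) (y : X) :
    (Fin.snoc z y : Fin (k + n + 1) → X) ∘ Fin.natAdd k =
      (Fin.snoc (z ∘ Fin.natAdd k) y : Fin (n + 1) → X) := by
  funext i
  refine Fin.lastCases ?_ (fun i => ?_) i
  · rw [Fin.snoc_last]
    exact Fin.snoc_last (α := fun _ => X) y z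
  · rw [Fin.snoc_castSucc]
    exact Fin.snoc_castSucc (α := fun _ => X) y z (Fin.natAdd k i)

/-- The k new slots precede the n old ones, so the variable of a quantifier stays last and the
induction passes through `sup` and `inf`. -/
theorem BoundedFormula.value_relabel (M : MetricStructure.{u, v, w} L) {α β : Type*} {k : ℕ}
    (g : α → β ⊕ Fin k) (x : β → M) {n : ℕ} (φ : BoundedFormula L α n) (z : Fin (k + n) → M) :
    (φ.relabel g).value M x z =
      φ.value M (Sum.elim x (z ∘ Fin.castAdd n) ∘ g) (z ∘ Fin.natAdd k) := by
  induction φ with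
  | dist s t => simp only [relabel, value, termValue_relabel, elim_comp_relabelVar]
  | pred R ts => simp only [relabel, value, termValue_relabel, elim_comp_relabelVar]
  | conn c φs ih => simp only [relabel, value, ih]
  | sup φ ih =>
    simp only [relabel, value]
    refine iSup_congr fun y => ?_
    rw [← snoc_comp_natAdd, ← snoc_comp_castAdd z y]
    exact ih (Fin.snoc z y)
  | inf φ ih =>
    simp only [relabel, value]
    refine iInf_congr fun y => ?_
    rw [← snoc_comp_natAdd, ← snoc_comp_castAdd z y]
    exact ih (Fin.snoc z y)

/-- Take the supremum over all variables that are available for quantification. -/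
def BoundedFormula.sups {β : Type*} : {k : ℕ} → BoundedFormula L β k → Formula L β
  | 0, φ => φ
  | _ + 1, φ => φ.sup.sups

theorem BoundedFormula.eval_sups_eq_zero_iff (M : MetricStructure.{u, v, w} L) {β : Type*}
    (x : β → M) {k : ℕ} (φ : BoundedFormula L β k) :
    Formula.eval φ.sups M x = 0 ↔ ∀ z : Fin k → M, φ.value M x z = 0 := by
  induction k with
  | zero =>
    refine ⟨fun h z => ?_, fun h => h _⟩
    rwa [Subsingleton.elim z Fin.elim0]
  | succ k ih =>
    refine (ih φ.sup).trans ⟨fun h z => ?_, fun h z => ?_⟩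
    · refine le_antisymm ?_ unitInterval.nonneg'
      rw [← Fin.snoc_init_self z, ← h (Fin.init z)]
      exact le_iSup (fun y => φ.value M x (Fin.snoc (Fin.init z) y)) (z (Fin.last k))
    · refine le_antisymm (iSup_le fun y => ?_) unitInterval.nonneg'
      exact (h _).le

/-! ### Monotonicity in elementary extensions -/

/-- The connective `(s, t) ↦ max (s - t) 0`. -/
noncomputable def truncatedSub : C(Fin 2 → unitInterval, unitInterval) where
  toFun s := Set.projIcc 0 1 zero_le_one ((s 0 : ℝ) - s 1)
  continuous_toFun := by fun_prop

theorem truncatedSub_eq_zero_iff (s : Fin 2 → unitInterval) :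
    truncatedSub s = 0 ↔ s 0 ≤ s 1 := by
  change Set.projIcc (0 : ℝ) 1 zero_le_one _ = ⟨0, Set.left_mem_Icc.2 zero_le_one⟩ ↔ _
  rw [Set.projIcc_eq_left zero_lt_one, sub_nonpos]
  rfl

/-- The formula `sup_x (φ(x,y) - φ(x,y'))` in the variables `y, y'`, where the subtraction is
truncated. It vanishes exactly if `φ(x,y) ≤ φ(x,y')` for all `x`. -/
noncomputable def Formula.leFormula {m n : ℕ} (φ : Formula L (Fin m ⊕ Fin n)) :
    Formula L (Fin (n + n)) :=
  BoundedFormula.sups (k := m) (.conn truncatedSub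
    ![φ.relabel (Sum.elim Sum.inr (Sum.inl ∘ Fin.castAdd n)),
      φ.relabel (Sum.elim Sum.inr (Sum.inl ∘ Fin.natAdd n))])

theorem Formula.eval_leFormula_eq_zero_iff (M : MetricStructure.{u, v, w} L) {m n : ℕ}
    (φ : Formula L (Fin m ⊕ Fin n)) (y y' : Fin n → M) :
    φ.leFormula.eval M (Fin.append y y') = 0 ↔ ∀ x, φ.eval₂ M x y ≤ φ.eval₂ M x y' := by
  rw [leFormula, BoundedFormula.eval_sups_eq_zero_iff]
  refine forall_congr' fun x => ?_
  rw [BoundedFormula.value, truncatedSub_eq_zero_iff]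
  simp only [Matrix.cons_val_zero, Matrix.cons_val_one]
  have key (g : Fin n → Fin (n + n)) (y₀ : Fin n → M) (hg : Fin.append y y' ∘ g = y₀) :
      (φ.relabel (Sum.elim Sum.inr (Sum.inl ∘ g)) : BoundedFormula L _ m).value M
        (Fin.append y y') x = φ.eval₂ M x y₀ := by
    refine (BoundedFormula.value_relabel M _ _ φ x).trans ?_
    rw [eval₂, eval]
    congr 1
    · funext i
      rcases i with i | i
      · rfl
      · exact congrFun hg i
    · exact Subsingleton.elim _ _
  rw [key (Fin.castAdd n) y (by funext i; simp), key (Fin.natAdd n) y' (by funext i; exact Fin.append_right y y' i)]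

/-- The hypothesis quantifies over tuples of M only, but it is the vanishing of one formula at (y,
y'), and an elementary embedding preserves that. -/
theorem IsElementaryEmbedding.eval₂_le {M N : MetricStructure.{u, v, w} L} {j : M → N}
    (hj : IsElementaryEmbedding M N j) {m n : ℕ} (φ : Formula L (Fin m ⊕ Fin n))
    {y y' : Fin n → M} (h : ∀ x, φ.eval₂ M x y ≤ φ.eval₂ M x y') (c : Fin m → N) :
    φ.eval₂ N c (j ∘ y) ≤ φ.eval₂ N c (j ∘ y') := by
  refine (φ.eval_leFormula_eq_zero_iff N (j ∘ y) (j ∘ y')).1 ?_ c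
  rw [← (φ.eval_leFormula_eq_zero_iff M y y').2 h, ← hj]
  congr 1
  funext i
  refine Fin.addCases (fun i => ?_) (fun i => ?_) i
  · rw [Function.comp_apply, Fin.append_left, Fin.append_left, Function.comp_apply]
  · rw [Function.comp_apply, Fin.append_right, Fin.append_right, Function.comp_apply]

/-! ### Linear combinations of monotone sequences and of the summing basis -/

theorem summingBasis_apply (i j : ℕ) : summingBasis i j = if j ≤ i then 1 else 0 := by
  have h : ∀ s : Finset ℕ, (∑ l ∈ s, c0UnitVector l) j = ∑ l ∈ s, (Pi.single l 1 : ℕ → ℝ) j := by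
    intro s
    induction s using Finset.cons_induction with
    | empty => rfl
    | cons l s hl ih => rw [Finset.sum_cons, Finset.sum_cons, ← ih]; rfl
  rw [summingBasis, h]
  simp [Pi.single_apply]

theorem sum_smul_summingBasis_apply (k : ℕ) (r : ℕ → ℝ) (j : ℕ) :
    (∑ i ∈ Finset.range k, r i • summingBasis i) j =
      ∑ i ∈ Finset.range k, r i * if j ≤ i then 1 else 0 := by
  induction k with
  | zero => rfl
  | succ k ih =>
    rw [Finset.sum_range_succ, Finset.sum_range_succ, ← ih, ← summingBasis_apply]
    rfl

theorem abs_apply_le_norm (f : C₀(ℕ, ℝ)) (j : ℕ) : |f j| ≤ ‖f‖ := by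
  rw [← ZeroAtInftyContinuousMap.norm_toBCF_eq_norm]
  exact f.toBCF.norm_coe_le_norm j

/-- Abel summation: linear combinations of an increasing sequence in `[0,1]` are bounded by the
largest tail of the coefficients. -/
theorem abs_sum_mul_le_of_monotone {g : ℕ → ℝ} (hg : Monotone g) (h0 : 0 ≤ g 0)
    (h1 : ∀ i, g i ≤ 1) (k : ℕ) (r : ℕ → ℝ) {B : ℝ}
    (hB : ∀ j, |∑ i ∈ Finset.range k, r i * if j ≤ i then 1 else 0| ≤ B) :
    |∑ i ∈ Finset.range k, r i * g i| ≤ B := by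
  have hB0 : 0 ≤ B := (abs_nonneg _).trans (hB 0)
  -- G is g shifted by one with G 0 = 0, so that g 0 counts as the first increment.
  let G : ℕ → ℝ := fun i => Nat.casesOn i 0 g
  have hG : ∀ j, 0 ≤ G (j + 1) - G j := by
    rintro (_ | j)
    · simpa [G] using h0
    · simpa [G] using hg j.le_succ
  have hG1 : G k ≤ 1 := by
    rcases k with _ | k
    · exact zero_le_one
    · exact h1 k
  have hsum : ∀ i ∈ Finset.range k,
      g i = ∑ j ∈ Finset.range k, (G (j + 1) - G j) * if j ≤ i then 1 else 0 := by
    intro i hi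
    have hi := Finset.mem_range.1 hi
    have hf : (Finset.range k).filter (· ≤ i) = Finset.range (i + 1) := by
      ext j
      simp only [Finset.mem_filter, Finset.mem_range]
      omega
    simp only [mul_ite, mul_one, mul_zero]
    rw [← Finset.sum_filter, hf, Finset.sum_range_sub]
    simp [G]
  have hswap : ∑ i ∈ Finset.range k, r i * g i = ∑ j ∈ Finset.range k,
      (G (j + 1) - G j) * ∑ i ∈ Finset.range k, r i * if j ≤ i then 1 else 0 := by
    rw [Finset.sum_congr rfl fun i hi => congrArg (r i * ·) (hsum i hi)]
    simp only [Finset.mul_sum]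
    rw [Finset.sum_comm]
    exact Finset.sum_congr rfl fun _ _ => Finset.sum_congr rfl fun _ _ => by ring
  calc |∑ i ∈ Finset.range k, r i * g i|
      ≤ ∑ j ∈ Finset.range k, (G (j + 1) - G j) * B := by
        rw [hswap]
        refine (Finset.abs_sum_le_sum_abs _ _).trans (Finset.sum_le_sum fun j _ => ?_)
        rw [abs_mul, abs_of_nonneg (hG j)]
        exact mul_le_mul_of_nonneg_left (hB j) (hG j)
    _ = G k * B := by
        rw [← Finset.sum_mul, Finset.sum_range_sub]
        simp [G]
    _ ≤ B := mul_le_of_le_one_left hB0 hG1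

theorem sum_smul_instanceFun_apply (U : MetricStructure.{u, v, w} L) {m n : ℕ}
    (φ : Formula L (Fin m ⊕ Fin n)) (a : ℕ → Fin n → U) (k : ℕ) (r : ℕ → ℝ) (p : phiTypes U φ) :
    (∑ i ∈ Finset.range k, r i • instanceFun U φ (a i)) p =
      ∑ i ∈ Finset.range k, r i * (p.1 (a i) : ℝ) := by
  induction k with
  | zero => rfl
  | succ k ih =>
    rw [Finset.sum_range_succ, Finset.sum_range_succ, ← ih]
    rfl

theorem eval₂_mem_phiTypes (U : MetricStructure.{u, v, w} L) {m n : ℕ}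
    (φ : Formula L (Fin m ⊕ Fin n)) (c : Fin m → U) : φ.eval₂ U c ∈ phiTypes U φ :=
  ⟨U, id, c, fun _ _ _ => rfl, fun _ => rfl⟩

/-- A monotone sequence of instances of `φ` that is shattered by the half graph with values `0`
and `1` is isometrically equivalent to the summing basis. -/
theorem equivalentSequences_summingBasis (U : MetricStructure.{u, v, w} L) {m n : ℕ}
    (φ : Formula L (Fin m ⊕ Fin n)) (a : ℕ → Fin n → U) (b : ℕ → Fin m → U)
    (hmono : ∀ i x, φ.eval₂ U x (a i) ≤ φ.eval₂ U x (a (i + 1)))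
    (hb : ∀ i j, (φ.eval₂ U (b j) (a i) : ℝ) = if j ≤ i then 1 else 0) :
    EquivalentSequences (fun i => instanceFun U φ (a i)) summingBasis := by
  refine ⟨1, 1, one_pos, one_pos, fun k r => ?_⟩
  simp only [one_mul]
  constructor
  · rw [← ZeroAtInftyContinuousMap.norm_toBCF_eq_norm]
    refine (BoundedContinuousFunction.norm_le (norm_nonneg _)).2 fun j => ?_
    -- The type of b j, realised in U itself, picks out the j-th tail sum.
    have h := (∑ i ∈ Finset.range k, r i • instanceFun U φ (a i)).norm_coe_le_norm
      ⟨_, eval₂_mem_phiTypes U φ (b j)⟩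
    rw [sum_smul_instanceFun_apply] at h
    simp only [hb] at h
    rw [← sum_smul_summingBasis_apply] at h
    exact h
  · refine (BoundedContinuousFunction.norm_le (norm_nonneg _)).2 fun p => ?_
    rw [sum_smul_instanceFun_apply]
    obtain ⟨p, N, j, c, hj, hp⟩ := p
    refine abs_sum_mul_le_of_monotone (g := fun i => (p (a i) : ℝ)) ?_ (p _).2.1
      (fun i => (p _).2.2) k r fun l => ?_
    · refine monotone_nat_of_le_succ fun i => ?_
      rw [hp, hp]
      exact hj.eval₂_le φ (hmono i) c
    · rw [← sum_smul_summingBasis_apply]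
      exact abs_apply_le_norm _ l

/-! ### Extracting a half graph -/

/-- A threshold that separates the small and the large values of a matrix with the strict order
property. -/
theorem exists_threshold {f : ℕ → ℕ → ℝ} {ε : ℝ} (hε : 0 < ε) (h0 : ∀ i j, 0 ≤ f i j)
    (h1 : ∀ i j, f i j ≤ 1) (hf : ∀ i, Monotone fun l => f l i)
    (h : ∀ i j, i < j → f i j + ε ≤ f j (i + 1)) :
    ∃ t : ℝ, (∀ i, ∃ᶠ j in Filter.atTop, f i j ≤ t) ∧
      ∀ᶠ j in Filter.atTop, ∃ i, t + ε / 2 ≤ f i j := by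
  let S : Set ℝ := {t | ∀ i, ∃ᶠ j in Filter.atTop, f i j ≤ t}
  have hS1 : (1 : ℝ) ∈ S := fun i => (Filter.Eventually.of_forall (h1 i)).frequently
  have hS0 : BddBelow S := ⟨0, fun t ht => by
    obtain ⟨j, hj⟩ := (ht 0).exists
    exact (h0 0 j).trans hj⟩
  -- The infimum need not lie in S. Room of ε/4 on either side of it still leaves a gap of ε/2 out
  -- of ε.
  obtain ⟨s, hs, hst⟩ := exists_lt_of_csInf_lt ⟨1, hS1⟩
    (show sInf S < sInf S + ε / 4 by linarith)
  refine ⟨s, hs, ?_⟩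
  have hlow : sInf S - ε / 4 ∉ S := fun hmem => by
    have := csInf_le hS0 hmem
    linarith
  simp only [S, Set.mem_ofPred_eq, not_forall, Filter.not_frequently, not_le] at hlow
  obtain ⟨i, hi⟩ := hlow
  filter_upwards [Filter.eventually_ge_atTop (i + 1)] with j hj
  obtain ⟨l, hl, hjl⟩ := (hi.and (Filter.eventually_ge_atTop j)).exists
  refine ⟨l, ?_⟩
  -- The index j - 1 makes the larger side of SOP land in column j; it is at least i, so
  -- monotonicity bounds f (j - 1) l below by f i l.
  have h2 := h (j - 1) l (by omega)
  rw [Nat.sub_add_cancel (by omega)] at h2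
  have h3 : f i l ≤ f (j - 1) l := hf l (by omega)
  linarith

/-- Subsequences along which a matrix that is increasing in its first index has small values
strictly below the diagonal and large ones elsewhere. -/
theorem exists_half_graph {f : ℕ → ℕ → ℝ} {s t : ℝ} (hf : ∀ i, Monotone fun l => f l i)
    (hs : ∀ i, ∃ᶠ j in Filter.atTop, f i j ≤ s)
    (ht : ∀ᶠ j in Filter.atTop, ∃ i, t ≤ f i j) :
    ∃ α β : ℕ → ℕ, Monotone α ∧ (∀ i j, i < j → f (α i) (β j) ≤ s) ∧
      ∀ i j, j ≤ i → t ≤ f (α i) (β j) := by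
  have step (l : ℕ) : ∃ q : ℕ × ℕ, l ≤ q.1 ∧ f l q.2 ≤ s ∧ t ≤ f q.1 q.2 := by
    obtain ⟨j, hj, i, hi⟩ := ((hs l).and_eventually ht).exists
    -- Enlarging the row index keeps the lower bound and ensures progress past l.
    exact ⟨(max l i, j), le_max_left _ _, hj, hi.trans (hf j (le_max_right _ _))⟩
  choose q hq hqs hqt using step
  let γ : ℕ → ℕ := fun i => (fun l => (q l).1)^[i] 0
  have hγ (i : ℕ) : γ (i + 1) = (q (γ i)).1 := Function.iterate_succ_apply' _ _ _
  have hmono : Monotone γ := monotone_nat_of_le_succ fun i => (hq _).trans_eq (hγ i).symm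
  -- Column j is small at row γ j and large at row γ (j + 1). The shift in α puts the diagonal on
  -- the large side, as in s_i, whose i-th coordinate is 1.
  refine ⟨fun i => γ (i + 1), fun j => (q (γ j)).2, fun i j hij => hmono (by omega),
    fun i j hij => (hf _ (hmono hij)).trans (hqs _), fun i j hij => (hqt (γ j)).trans ?_⟩
  rw [← hγ]
  exact hf _ (hmono (by omega))

/-- The connective that sends `[0,s]` to `0` and `[s + δ,1]` to `1` and is affine in between. -/
noncomputable def stretch (s δ : ℝ) : C(Fin 1 → unitInterval, unitInterval) where
  toFun z := Set.projIcc 0 1 zero_le_one (((z 0 : ℝ) - s) / δ)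
  continuous_toFun := by fun_prop

theorem stretch_mono {s δ : ℝ} (hδ : 0 < δ) {z z' : Fin 1 → unitInterval} (h : z 0 ≤ z' 0) :
    stretch s δ z ≤ stretch s δ z' := by
  refine Set.monotone_projIcc zero_le_one ?_
  have : (z 0 : ℝ) ≤ z' 0 := h
  gcongr

theorem stretch_of_le {s δ : ℝ} (hδ : 0 < δ) {z : Fin 1 → unitInterval} (h : (z 0 : ℝ) ≤ s) :
    stretch s δ z = 0 :=
  Set.projIcc_of_le_left zero_le_one (div_nonpos_of_nonpos_of_nonneg (sub_nonpos.2 h) hδ.le)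

theorem stretch_of_ge {s δ : ℝ} (hδ : 0 < δ) {z : Fin 1 → unitInterval}
    (h : s + δ ≤ (z 0 : ℝ)) : stretch s δ z = 1 :=
  Set.projIcc_of_right_le zero_le_one ((one_le_div hδ).2 (by linarith))

theorem FormulaHasSOP.exists_equivalentSequences {U : MetricStructure.{u, v, w} L} {m n : ℕ}
    {φ : Formula L (Fin m ⊕ Fin n)} (h : FormulaHasSOP U φ) :
    ∃ (ψ : Formula L (Fin m ⊕ Fin n)) (a : ℕ → Fin n → U),
      EquivalentSequences (fun i => instanceFun U ψ (a i)) summingBasis := by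
  obtain ⟨ε, hε, a, b, hab⟩ := h
  have hmono (x : Fin m → U) : Monotone fun i => φ.eval₂ U x (a i) :=
    monotone_nat_of_le_succ fun i => (hab i (i + 1) i.lt_succ_self).1 x
  have hf (j : ℕ) : Monotone fun i => (φ.eval₂ U (b j) (a i) : ℝ) := fun _ _ hl => hmono (b j) hl
  obtain ⟨t, hs, ht⟩ := exists_threshold (f := fun i j => (φ.eval₂ U (b j) (a i) : ℝ)) hε
    (fun _ _ => unitInterval.nonneg _) (fun _ _ => unitInterval.le_one _) hf
    fun i j hij => (hab i j hij).2
  obtain ⟨α, β, hα, hlow, hhigh⟩ := exists_half_graph hf hs ht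
  refine ⟨.conn (stretch t (ε / 2)) fun _ => φ, fun i => a (α i),
    equivalentSequences_summingBasis U _ _ (fun j => b (β j)) (fun i x => ?_) fun i j => ?_⟩
  · exact stretch_mono (half_pos hε) (hmono x (hα i.le_succ))
  · split_ifs with hij
    · exact congrArg Subtype.val (stretch_of_ge (half_pos hε) (hhigh i j hij))
    · exact congrArg Subtype.val (stretch_of_le (half_pos hε) (hlow i j (not_le.1 hij)))

end ContinuousLogic

theorem proposition3p10 {L : ContinuousLogic.MetricLanguage.{u, v}}
    (T : ContinuousLogic.Theory L) (hT : ContinuousLogic.IsCompleteTheory.{u, v, w} T)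
    (κ : Cardinal.{w}) (U : ContinuousLogic.MetricStructure.{u, v, w} L)
    (hU : ContinuousLogic.IsMonsterModel κ T U) (hSOP : ContinuousLogic.HasSOP U) :
    ∃ (m n : ℕ) (φ : ContinuousLogic.Formula L (Fin m ⊕ Fin n)) (a : ℕ → Fin n → U),
      ContinuousLogic.EquivalentSequences
        (fun i => ContinuousLogic.instanceFun U φ (a i)) ContinuousLogic.summingBasis := by
  obtain ⟨m, n, φ, hφ⟩ := hSOP
  obtain ⟨ψ, a, h⟩ := hφ.exists_equivalentSequences
  exact ⟨m, n, ψ, a, h⟩
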